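/- Let $n\ge 0$ and let $\gamma\subset[0,1]^n$ be a simple curve, i.e. the image of a continuous map $c:[0,1]\to\mathbb R^n$ that is injective except that possibly $c(0)=c(1)$. Assume that $\gamma$ has finite length, $\mathcal H^1(\gamma)<\infty$, where $\mathcal H^1$ is the one-dimensional Hausdorff measure for the Euclidean metric. Let $f:\gamma\to\mathbb R$ be continuous, and for $x\in\gamma$ let $$l_f(x)=\liminf_{r\to0^+}\frac{\sup\{|f(y)-f(x)|: y\in\gamma,\ |y-x|\le r\}}{r}\in[0,\infty]$$ be its lower scaled oscillation on $\gamma$. Assume that $l_f(x)<\infty$ for all but at most countably many $x\in\gamma$. Then the set of points $x\in\gamma$ at which $f$ is differentiable has positive $\mathcal H^1$ measure. Here $f$ is differentiable at $x\in\gamma$ if there is a linear map $L:\mathbb R^n\to\mathbb R$ with $f(y)=f(x)+L(y-x)+o(|y-x|)$ as $y\to x$ in $\gamma$, and moreover the graph $G=\{(y,f(y)):y\in\gamma\}\subset\mathbb R^{n+1}$ has a non-vertical tangent line at $p=(x,f(x))$. The latter means that there is a one-dimensional subspace $W\subset\mathbb R^{n+1}$, not containing $(0,\dots,0,1)$, such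 that the set of all limits of $(q_k-p)/|q_k-p|$ over sequences $q_k\in G\setminus\{p\}$ with $q_k\to p$ for which the limit exists is exactly the set of (two) unit vectors of $W$. -/

import Mathlib

open Set Filter Topology MeasureTheory
open scoped ENNReal

/-- `γ` is a simple curve: the image of a continuous map on `[0,1]` that is injective, except that
the two endpoints are allowed to coincide (so arcs and simple closed curves are both included). -/
def IsSimpleCurve {V : Type*} [TopologicalSpace V] (γ : Set V) : Prop :=
  ∃ c : ℝ → V, ContinuousOn c (Icc 0 1) ∧
    (∀ s ∈ Icc (0 : ℝ) 1, ∀ t ∈ Icc (0 : ℝ) 1, s < t → c s = c t → s = 0 ∧ t = 1) ∧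
    c '' Icc 0 1 = γ

/-- The lower scaled oscillation
`l_f(x) = liminf_{r → 0+} (sup_{d(x,y) ≤ r} ‖f(y) - f(x)‖) / r`, with values in `[0,∞]`. -/
noncomputable def lowerScaledOscillation {X F : Type*} [PseudoMetricSpace X]
    [SeminormedAddCommGroup F] (f : X → F) (x : X) : ℝ≥0∞ :=
  liminf (fun r : ℝ => (⨆ y ∈ Metric.closedBall x r, ‖f y - f x‖ₑ) / ENNReal.ofReal r) (𝓝[>] 0)

/-- The contingent of `E` at `x`, each intermediate half-tangent `{x + t u : t ≥ 0}` being
recorded by its unit direction vector `u`. -/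
def contingentDirections {V : Type*} [NormedAddCommGroup V] [NormedSpace ℝ V]
    (E : Set V) (x : V) : Set V :=
  {u | ∃ y : ℕ → V, (∀ k, y k ∈ E ∧ y k ≠ x) ∧ Tendsto y atTop (𝓝 x) ∧
    Tendsto (fun k => ‖y k - x‖⁻¹ • (y k - x)) atTop (𝓝 u)}

/-- The line `x + W` is the tangent of `E` at `x`: the contingent of `E` at `x` is exactly this
line, i.e. it consists of exactly the two half-lines of `x + W` issuing from `x`. -/
def IsTangentLineAt {V : Type*} [NormedAddCommGroup V] [NormedSpace ℝ V]
    (E : Set V) (x : V) (W : Submodule ℝ V) : Prop :=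
  Module.finrank ℝ W = 1 ∧ contingentDirections E x = {u | u ∈ W ∧ ‖u‖ = 1}

/-- The point `(x, t)` of `V × ℝ`, the product carrying the Euclidean norm. -/
def graphPoint {V : Type*} (x : V) (t : ℝ) : WithLp 2 (V × ℝ) := WithLp.toLp 2 (x, t)

/-- The graph of a real function on a subset of a Euclidean space. -/
def graphOn {V : Type*} {γ : Set V} (f : γ → ℝ) : Set (WithLp 2 (V × ℝ)) :=
  range fun x : γ => graphPoint (x : V) (f x)

/-- Differentiability at `x` of a function `f` defined on a curve `γ`: `f` has a first order
expansion at `x` along `γ`, and the graph of `f` has a tangent line over `x` which is not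
vertical. (For finite-dimensional `V` the second clause implies the first; it says moreover that `γ` itself has a tangent line
at `x`.) -/
def DifferentiableAtOnCurve {V : Type*} [NormedAddCommGroup V] [InnerProductSpace ℝ V]
    {γ : Set V} (f : γ → ℝ) (x : γ) : Prop :=
  (∃ L : V →L[ℝ] ℝ, (fun y : γ => f y - f x - L ((y : V) - (x : V)))
      =o[𝓝 x] fun y : γ => (y : V) - (x : V)) ∧
  ∃ W : Submodule ℝ (WithLp 2 (V × ℝ)),
    IsTangentLineAt (graphOn f) (graphPoint (x : V) (f x)) W ∧ graphPoint (0 : V) 1 ∉ W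

/-! Arc length `Γ` on `[0, l]` reduces the claim to one variable. Since `Γ` is 1-Lipschitz, `F = f ∘
Γ` inherits finite lower scaled oscillation off a countable set of interior parameters. `Γ` is
differentiable a.e., and `Γ' = 0` only on a null set, because the image of that set is null and arc
length preserves measure. Where `F' ` and `Γ' ≠ 0` both exist, `(Γ, F)` has a velocity with nonzero
horizontal part, which yields the expansion and the non-vertical tangent. So it suffices that `F` is
differentiable on a set of positive measure (`volume_differentiableAt_pos`).

If `F` is constant this is clear; otherwise, up to sign, `F a < F b` for some `a < b`. A covering
argument shows that almost every level between them has a countable preimage. Such a preimage is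
closed and nonempty, so it has an isolated point. Unless the level is one of countably many extremal
values, `F` crosses it there. At a crossing `F` is touched from above by a running supremum and from
below by a running infimum; both are monotone, so Lebesgue's theorem makes `F` differentiable at
almost every crossing. If `F` were differentiable only on a null set, the crossings would be null;
finite oscillation would make their image null too, yet that image contains almost every level in
`(F a, F b)`. -/

/-! ### Arc-length parametrization -/

theorem IsPreconnected.edist_le_hausdorffMeasure {X : Type*} [MetricSpace X] [MeasurableSpace X]
    [BorelSpace X] {s : Set X} (hs : IsPreconnected s) {x y : X} (hx : x ∈ s) (hy : y ∈ s) :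
    edist x y ≤ μH[1] s := by
  have hL : LipschitzWith 1 (fun z : X => dist z x) := LipschitzWith.dist_left x
  have h1 := hL.hausdorffMeasure_image_le (d := 1) zero_le_one s
  have h2 : Icc 0 (dist y x) ⊆ (fun z : X => dist z x) '' s := by
    have := hs.intermediate_value hx hy hL.continuous.continuousOn
    simpa using this
  have h3 : ENNReal.ofReal (dist y x) ≤ μH[1] ((fun z : X => dist z x) '' s) := by
    rw [hausdorffMeasure_real]
    calc ENNReal.ofReal (dist y x) = volume (Icc 0 (dist y x)) := by simp
      _ ≤ _ := measure_mono h2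
  rw [edist_comm, edist_dist]
  refine h3.trans (h1.trans ?_)
  simp

theorem exists_measure_eq_measure_image {X : Type*} [MetricSpace X] [MeasurableSpace X]
    [BorelSpace X] (μ : Measure X) {c : ℝ → X} {U : Set ℝ} (hU : MeasurableSet U)
    (hc : ContinuousOn c U) (hinj : InjOn c U) :
    ∃ ν : Measure ℝ, ∀ S, ν S = μ (c '' (S ∩ U)) := by
  have he := hc.measurableEmbedding hU hinj
  refine ⟨(μ.comap (U.domRestrict c)).map Subtype.val, fun S => ?_⟩
  rw [(MeasurableEmbedding.subtype_coe hU).map_apply, he.comap_apply]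
  congr 1
  ext x
  simp [and_comm]

theorem hausdorffMeasure_image_eq_volume_of_Ioo {X : Type*} [MetricSpace X]
    [MeasurableSpace X] [BorelSpace X] {Γ : ℝ → X} {l : ℝ}
    (hΓ : ContinuousOn Γ (Ioo 0 l)) (hinj : InjOn Γ (Ioo 0 l))
    (h : ∀ s t, 0 ≤ s → s < t → t ≤ l → μH[1] (Γ '' Ioo s t) = ENNReal.ofReal (t - s))
    {S : Set ℝ} (hS : S ⊆ Ioo 0 l) : μH[1] (Γ '' S) = volume S := by
  obtain ⟨ν, hν⟩ := exists_measure_eq_measure_image μH[1] measurableSet_Ioo hΓ hinj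
  have key : volume.restrict (Ioo 0 l) = ν := by
    refine Real.measure_ext_Ioo_rat fun a b => ?_
    rw [Measure.restrict_apply measurableSet_Ioo, hν, Ioo_inter_Ioo]
    rcases lt_or_ge (max (a : ℝ) 0) (min (b : ℝ) l) with hlt | hge
    · rw [Real.volume_Ioo]
      exact (h _ _ (le_max_right _ _) hlt (min_le_right _ _)).symm
    · have : Ioo (max (a : ℝ) 0) (min (b : ℝ) l) = ∅ := Ioo_eq_empty (not_lt.2 hge)
      change volume (Ioo (max (a : ℝ) 0) (min (b : ℝ) l)) =
        μH[1] (Γ '' (Ioo (max (a : ℝ) 0) (min (b : ℝ) l)))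
      simp [this]
  have := hν S
  rw [inter_eq_left.2 hS, ← key, Measure.restrict_apply' measurableSet_Ioo,
    inter_eq_left.2 hS] at this
  exact this.symm

/-- The new parameter is the length `σ t` of `c '' Ioc 0 t`. It is continuous because points have no
length, and strictly increasing because the length of an arc bounds the distance of its endpoints;
the same bound makes `c ∘ σ⁻¹` 1-Lipschitz. -/
theorem IsSimpleCurve.exists_arcLength_parametrization {V : Type*} [MetricSpace V]
    [MeasurableSpace V] [BorelSpace V] {γ : Set V} (hγ : IsSimpleCurve γ) (hlen : μH[1] γ < ⊤) :
    ∃ (l : ℝ) (Γ : ℝ → V), 0 < l ∧ LipschitzOnWith 1 Γ (Icc 0 l) ∧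
      (∀ s ∈ Icc 0 l, ∀ t ∈ Icc 0 l, s < t → Γ s = Γ t → s = 0 ∧ t = l) ∧
      Γ '' Icc 0 l = γ ∧ ∀ S ⊆ Ioo 0 l, μH[1] (Γ '' S) = volume S := by
  obtain ⟨c, hc, hinj, rfl⟩ := hγ
  have hinj' : InjOn c (Ioo 0 1) := by
    intro s hs t ht hst
    rcases lt_trichotomy s t with h | h | h
    · exact absurd (hinj s (Ioo_subset_Icc_self hs) t (Ioo_subset_Icc_self ht) h hst).1 hs.1.ne'
    · exact h
    · exact absurd
        (hinj t (Ioo_subset_Icc_self ht) s (Ioo_subset_Icc_self hs) h hst.symm).1 ht.1.ne'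
  obtain ⟨ν, hν⟩ := exists_measure_eq_measure_image μH[1] measurableSet_Ioo
    (hc.mono Ioo_subset_Icc_self) hinj'
  have : IsFiniteMeasure ν := ⟨by
    rw [hν]
    exact (measure_mono (image_mono (inter_subset_right.trans Ioo_subset_Icc_self))).trans_lt hlen⟩
  have hsing : ∀ x : V, μH[1] ({x} : Set V) = 0 :=
    fun x => (Measure.nullSingletonClass_hausdorff V zero_lt_one).measure_singleton x
  have : NullSingletonClass ν := ⟨fun x => by
    rw [hν]
    refine measure_mono_null (t := {c x}) ?_ (hsing _)
    rintro _ ⟨y, ⟨rfl, -⟩, rfl⟩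
    rfl⟩
  have hνIoo : ∀ s t, 0 ≤ s → t ≤ 1 → ν (Ioo s t) = μH[1] (c '' Ioo s t) := by
    intro s t hs ht
    rw [hν, inter_eq_left.2 (Ioo_subset_Ioo hs ht)]
  set σ : ℝ → ℝ := fun t => ν.real (Ioc 0 t) with hσ
  have hσc : ContinuousOn σ (Icc 0 1) := by
    have := intervalIntegral.continuousOn_primitive (μ := ν) (f := fun _ : ℝ => (1 : ℝ)) (a := 0) (b := 1)
      (integrableOn_const)
    simpa [hσ] using this
  have hσsub : ∀ s t, 0 ≤ s → s ≤ t → σ t - σ s = ν.real (Ioo s t) := by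
    intro s t hs hst
    have h1 : Ioc 0 t = Ioc 0 s ∪ Ioc s t := (Ioc_union_Ioc_eq_Ioc hs hst).symm
    have h2 : ν.real (Ioc s t) = ν.real (Ioo s t) := measureReal_congr Ioo_ae_eq_Ioc.symm
    simp only [hσ]
    rw [h1, measureReal_union (Ioc_disjoint_Ioc_of_le le_rfl) measurableSet_Ioc, h2]
    ring
  have hdist : ∀ s t, 0 ≤ s → s ≤ t → t ≤ 1 → dist (c s) (c t) ≤ σ t - σ s := by
    intro s t hs hst ht
    rw [hσsub s t hs hst, Measure.real, ← ENNReal.ofReal_le_iff_le_toReal (measure_ne_top _ _),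
      ← edist_dist, hνIoo s t hs ht]
    have hpre : IsPreconnected (c '' Icc s t) :=
      isPreconnected_Icc.image c (hc.mono (Icc_subset_Icc hs ht))
    refine (hpre.edist_le_hausdorffMeasure (mem_image_of_mem c (left_mem_Icc.2 hst))
      (mem_image_of_mem c (right_mem_Icc.2 hst))).trans ?_
    have : c '' Icc s t ⊆ c '' Ioo s t ∪ ({c s} ∪ {c t}) := by
      rintro _ ⟨x, hx, rfl⟩
      rcases eq_or_lt_of_le hx.1 with h | h
      · simp [h]
      rcases eq_or_lt_of_le hx.2 with h' | h'
      · simp [h']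
      exact Or.inl ⟨x, ⟨h, h'⟩, rfl⟩
    refine (measure_mono this).trans ((measure_union_le _ _).trans ?_)
    have h0 : μH[1] ({c s} ∪ {c t} : Set V) = 0 := measure_union_null (hsing _) (hsing _)
    rw [h0, add_zero]
  have hmono : MonotoneOn σ (Icc 0 1) := fun s hs t ht hst => by
    have := (dist_nonneg).trans (hdist s t hs.1 hst ht.2)
    linarith
  have hstrict : StrictMonoOn σ (Icc 0 1) := by
    intro s hs t ht hst
    have hm : (s + t) / 2 ∈ Icc (0 : ℝ) 1 := ⟨by linarith [hs.1, ht.1], by linarith [hs.2, ht.2]⟩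
    have h1 : σ s < σ ((s + t) / 2) := by
      have hne : c s ≠ c ((s + t) / 2) := fun h => by
        have := (hinj s hs _ hm (by linarith) h).2
        linarith [ht.2]
      have := (dist_pos.2 hne).trans_le (hdist s _ hs.1 (by linarith) hm.2)
      linarith
    exact h1.trans_le (hmono hm ht (by linarith))
  have h01 : (0 : ℝ) ∈ Icc (0 : ℝ) 1 := by simp
  have h11 : (1 : ℝ) ∈ Icc (0 : ℝ) 1 := by simp
  have hσ0 : σ 0 = 0 := by simp [hσ]
  have hl : 0 < σ 1 := by
    rw [← hσ0]
    exact hstrict h01 h11 zero_lt_one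
  have hsurj : ∀ s ∈ Icc 0 (σ 1), ∃ t ∈ Icc (0 : ℝ) 1, σ t = s := by
    intro s hs
    have := intermediate_value_Icc zero_le_one hσc
    rw [hσ0] at this
    exact this hs
  choose! φ hφ hσφ using hsurj
  have hφσ : ∀ t ∈ Icc (0 : ℝ) 1, σ t ∈ Icc 0 (σ 1) ∧ φ (σ t) = t := by
    intro t ht
    have h : σ t ∈ Icc 0 (σ 1) := ⟨hσ0 ▸ hmono h01 ht ht.1, hmono ht h11 ht.2⟩
    exact ⟨h, hstrict.injOn (hφ _ h) ht (hσφ _ h)⟩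
  have hφlt : ∀ s ∈ Icc 0 (σ 1), ∀ t ∈ Icc 0 (σ 1), s < t → φ s < φ t := by
    intro s hs t ht hst
    rw [← hstrict.lt_iff_lt (hφ s hs) (hφ t ht), hσφ s hs, hσφ t ht]
    exact hst
  have hφ0 : φ 0 = 0 := by
    have := (hφσ 0 h01).2
    rwa [hσ0] at this
  have hφ1 : φ (σ 1) = 1 := (hφσ 1 h11).2
  have hlip : LipschitzOnWith 1 (c ∘ φ) (Icc 0 (σ 1)) := by
    have main : ∀ s ∈ Icc 0 (σ 1), ∀ t ∈ Icc 0 (σ 1), s < t →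
        dist (c (φ s)) (c (φ t)) ≤ dist s t := by
      intro s hs t ht hst
      have := hdist _ _ (hφ s hs).1 (hφlt s hs t ht hst).le (hφ t ht).2
      rwa [hσφ s hs, hσφ t ht, ← abs_of_pos (sub_pos.2 hst), ← Real.dist_eq, dist_comm t s] at this
    refine LipschitzOnWith.of_dist_le_mul fun s hs t ht => ?_
    rw [NNReal.coe_one, one_mul]
    rcases lt_trichotomy s t with h | h | h
    · exact main s hs t ht h
    · simp [h]
    · rw [dist_comm s, dist_comm]
      exact main t ht s hs h
  have hsimple : ∀ s ∈ Icc 0 (σ 1), ∀ t ∈ Icc 0 (σ 1), s < t → (c ∘ φ) s = (c ∘ φ) t →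
      s = 0 ∧ t = σ 1 := by
    intro s hs t ht hst h
    obtain ⟨h0, h1⟩ := hinj _ (hφ s hs) _ (hφ t ht) (hφlt s hs t ht hst) h
    rw [← hσφ s hs, ← hσφ t ht, h0, h1]
    exact ⟨hσ0, rfl⟩
  have hIcc : Icc (0 : ℝ) 1 = φ '' Icc 0 (σ 1) := by
    ext t
    constructor
    · exact fun ht => ⟨σ t, hφσ t ht⟩
    · rintro ⟨s, hs, rfl⟩
      exact hφ s hs
  refine ⟨σ 1, c ∘ φ, hl, hlip, hsimple, by rw [image_comp, ← hIcc], fun S hS => ?_⟩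
  refine hausdorffMeasure_image_eq_volume_of_Ioo
    (hlip.continuousOn.mono Ioo_subset_Icc_self) ?_ ?_ hS
  · intro s hs t ht hst
    rcases lt_trichotomy s t with h | h | h
    · exact absurd (hsimple s (Ioo_subset_Icc_self hs) t (Ioo_subset_Icc_self ht) h hst).1 hs.1.ne'
    · exact h
    · exact absurd
        (hsimple t (Ioo_subset_Icc_self ht) s (Ioo_subset_Icc_self hs) h hst.symm).1 ht.1.ne'
  · intro s t hs hst ht
    have hs' : s ∈ Icc 0 (σ 1) := ⟨hs, hst.le.trans ht⟩
    have ht' : t ∈ Icc 0 (σ 1) := ⟨hs.trans hst.le, ht⟩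
    have himg : φ '' Ioo s t = Ioo (φ s) (φ t) := by
      ext x
      constructor
      · rintro ⟨y, hy, rfl⟩
        have hy' : y ∈ Icc 0 (σ 1) := ⟨hs.trans hy.1.le, hy.2.le.trans ht⟩
        exact ⟨hφlt s hs' y hy' hy.1, hφlt y hy' t ht' hy.2⟩
      · rintro hx
        have hx' : x ∈ Icc (0 : ℝ) 1 := ⟨(hφ s hs').1.trans hx.1.le, hx.2.le.trans (hφ t ht').2⟩
        refine ⟨σ x, ⟨?_, ?_⟩, (hφσ x hx').2⟩
        · have := hstrict (hφ s hs') hx' hx.1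
          rwa [hσφ s hs'] at this
        · have := hstrict hx' (hφ t ht') hx.2
          rwa [hσφ t ht'] at this
    rw [image_comp, himg, ← hνIoo _ _ (hφ s hs').1 (hφ t ht').2,
      ← ENNReal.ofReal_toReal (measure_ne_top ν _)]
    have := hσsub _ _ (hφ s hs').1 (hφlt s hs' t ht' hst).le
    rw [hσφ s hs', hσφ t ht', Measure.real] at this
    rw [this]

/-- For every `ε > 0`, `Z` splits into countably many pieces on which `Γ` is `ε`-Lipschitz. -/
theorem hausdorffMeasure_image_eq_zero_of_hasDerivAt_zero {V : Type*} [NormedAddCommGroup V]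
    [NormedSpace ℝ V] [SecondCountableTopology V] [MeasurableSpace V] [BorelSpace V] {Γ : ℝ → V}
    {Z : Set ℝ} (hZ : ∀ t ∈ Z, HasDerivAt Γ 0 t) (hfin : volume Z ≠ ⊤) : μH[1] (Γ '' Z) = 0 := by
  have main : ∀ ε : NNReal, ε ≠ 0 → μH[1] (Γ '' Z) ≤ ε * volume Z := by
    intro ε hε
    obtain ⟨t, A, hdisj, hmeas, hcov, happ, hA⟩ :=
      exists_partition_approximatesLinearOn_of_hasFDerivWithinAt Γ Z
        (fun _ => (0 : ℝ →L[ℝ] V)) (fun x hx => by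
          have := (hZ x hx).hasFDerivAt.hasFDerivWithinAt (s := Z)
          simpa using this) (fun _ => ε) (fun _ => hε)
    rcases Z.eq_empty_or_nonempty with rfl | hne
    · simp
    have hlip : ∀ n, LipschitzOnWith ε Γ (Z ∩ t n) := by
      intro n
      obtain ⟨y, -, hy⟩ := hA hne n
      have := happ n
      rw [hy] at this
      simpa using this.lipschitzOnWith
    have hpiece : ∀ n, μH[1] (Γ '' (Z ∩ t n)) ≤ ε * volume (Z ∩ t n) := by
      intro n
      have := (hlip n).hausdorffMeasure_image_le (d := 1) zero_le_one
      rwa [hausdorffMeasure_real, ENNReal.rpow_one] at this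
    have hZeq : Z = ⋃ n, Z ∩ t n := by rw [← inter_iUnion, inter_eq_left.2 hcov]
    calc μH[1] (Γ '' Z) = μH[1] (⋃ n, Γ '' (Z ∩ t n)) := by rw [← image_iUnion, ← hZeq]
      _ ≤ ∑' n, μH[1] (Γ '' (Z ∩ t n)) := measure_iUnion_le _
      _ ≤ ∑' n, ε * volume (Z ∩ t n) := ENNReal.tsum_le_tsum hpiece
      _ = ε * ∑' n, volume.restrict Z (t n) := by
        rw [ENNReal.tsum_mul_left]
        congr 2
        ext n
        rw [Measure.restrict_apply (hmeas n), inter_comm]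
      _ = ε * volume.restrict Z (⋃ n, t n) := by rw [measure_iUnion hdisj hmeas]
      _ ≤ ε * volume Z := by
        gcongr (ε : ℝ≥0∞) * ?_
        exact (measure_mono (subset_univ _)).trans_eq (Measure.restrict_apply_univ _)
  by_contra hne
  obtain ⟨ε, hε, hlt⟩ := ENNReal.exists_nnreal_pos_mul_lt hfin hne
  exact absurd (main ε hε.ne') (not_le.2 hlt)

/-! ### Coverings by balls of controlled oscillation -/

/-- The liminf provides arbitrarily small good radii at each centre, which is all that Besicovitch's
covering theorem needs. `F` maps each chosen ball into a ball `K` times as large. -/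
theorem exists_countable_closedBall_cover_of_frequently_oscillation_le {F : ℝ → ℝ} {K : ℝ}
    {S : Set ℝ} (hS : ∀ x ∈ S, ∃ᶠ r in 𝓝[>] (0 : ℝ), ∀ y, |y - x| ≤ r → |F y - F x| ≤ K * r)
    {ε : ℝ≥0∞} (hε : ε ≠ 0) {δ : ℝ} (hδ : 0 < δ) :
    ∃ (t : Set ℝ) (r : ℝ → ℝ), t.Countable ∧
      (∀ x ∈ t, r x < δ ∧ ∀ y, |y - x| ≤ r x → |F y - F x| ≤ K * r x) ∧
      S ⊆ ⋃ x ∈ t, Metric.closedBall x (r x) ∧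
      ∑' x : t, volume (Metric.closedBall (x : ℝ) (r x)) ≤ volume S + ε := by
  obtain ⟨t, r, htc, -, htr, hcov, hsum⟩ :=
    Besicovitch.exists_closedBall_covering_tsum_measure_le volume hε
      (fun x => {r | r < δ ∧ ∀ y, |y - x| ≤ r → |F y - F x| ≤ K * r}) S (by
        intro x hx η hη
        have h1 : ∀ᶠ r in 𝓝[>] (0 : ℝ), r ∈ Ioo 0 (min δ η) := Ioo_mem_nhdsGT (lt_min hδ hη)
        obtain ⟨r, hr, hr'⟩ := ((hS x hx).and_eventually h1).exists
        exact ⟨r, ⟨hr'.2.trans_le (min_le_left _ _), hr⟩, hr'.1,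
          hr'.2.trans_le (min_le_right _ _)⟩)
  exact ⟨t, r, htc, htr, hcov, hsum⟩

theorem volume_closedBall_mul {K : ℝ} (hK : 0 ≤ K) (x y r : ℝ) :
    volume (Metric.closedBall y (K * r)) =
      ENNReal.ofReal K * volume (Metric.closedBall x r) := by
  rw [Real.volume_closedBall, Real.volume_closedBall, ← ENNReal.ofReal_mul hK]
  congr 1
  ring

theorem volume_image_eq_zero_of_frequently_oscillation_le {F : ℝ → ℝ} {K : ℝ} (hK : 0 ≤ K)
    {S : Set ℝ} (hS : ∀ x ∈ S, ∃ᶠ r in 𝓝[>] (0 : ℝ), ∀ y, |y - x| ≤ r → |F y - F x| ≤ K * r)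
    (h0 : volume S = 0) : volume (F '' S) = 0 := by
  have main : ∀ ε : NNReal, 0 < ε → volume (F '' S) ≤ ε * ENNReal.ofReal K := by
    intro ε hε
    obtain ⟨t, r, htc, htr, hcov, hsum⟩ :=
      exists_countable_closedBall_cover_of_frequently_oscillation_le hS
        (ENNReal.coe_ne_zero.2 hε.ne') zero_lt_one
    have hsub : F '' S ⊆ ⋃ x ∈ t, Metric.closedBall (F x) (K * r x) := by
      rintro _ ⟨y, hy, rfl⟩
      obtain ⟨x, hx, hyx⟩ := mem_iUnion₂.1 (hcov hy)
      exact mem_iUnion₂.2 ⟨x, hx, (htr x hx).2 y hyx⟩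
    calc volume (F '' S) ≤ ∑' x : t, volume (Metric.closedBall (F x) (K * r x)) :=
          (measure_mono hsub).trans (measure_biUnion_le volume htc _)
      _ = ENNReal.ofReal K * ∑' x : t, volume (Metric.closedBall (x : ℝ) (r x)) := by
          rw [← ENNReal.tsum_mul_left]
          exact tsum_congr fun x => volume_closedBall_mul hK _ _ _
      _ ≤ ENNReal.ofReal K * ε := by
          rw [h0, zero_add] at hsum
          gcongr
      _ = _ := mul_comm _ _
  by_contra hne
  obtain ⟨ε, hε, hlt⟩ := ENNReal.exists_nnreal_pos_mul_lt (ENNReal.ofReal_ne_top (r := K)) hne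
  exact absurd (main ε hε) (not_le.2 hlt)

/-- Almost every level of a function of bounded lower scaled oscillation is attained finitely
often. -/
theorem ae_finite_inter_preimage_of_frequently_oscillation_le {F : ℝ → ℝ} {K : ℝ} (hK : 0 ≤ K)
    {S : Set ℝ} (hS : ∀ x ∈ S, ∃ᶠ r in 𝓝[>] (0 : ℝ), ∀ y, |y - x| ≤ r → |F y - F x| ≤ K * r)
    (hfin : volume S ≠ ⊤) : ∀ᵐ y, (S ∩ F ⁻¹' {y}).Finite := by
  have hcover := fun m : ℕ => exists_countable_closedBall_cover_of_frequently_oscillation_le hS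
    one_ne_zero (Nat.one_div_pos_of_nat (α := ℝ) (n := m))
  choose t r htc htr hcov hsum using hcover
  -- `N m y` counts the balls of the `m`-th cover whose enlarged image ball contains `y`. Its
  -- integral is bounded uniformly in `m`, so Fatou makes its liminf finite a.e.
  set N : ℕ → ℝ → ℝ≥0∞ := fun m y =>
    ∑' x : t m, (Metric.closedBall (F x) (K * r m x)).indicator 1 y with hN
  have hmeas : ∀ m, Measurable (N m) := by
    intro m
    have := (htc m).to_subtype
    exact Measurable.tsum fun x =>
      measurable_one.indicator Metric.isClosed_closedBall.measurableSet
  have hint : ∀ m, ∫⁻ y, N m y ≤ ENNReal.ofReal K * (volume S + 1) := by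
    intro m
    have := (htc m).to_subtype
    simp only [hN]
    rw [lintegral_tsum fun x =>
      (measurable_one.indicator Metric.isClosed_closedBall.measurableSet).aemeasurable]
    calc ∑' x : t m, ∫⁻ y, (Metric.closedBall (F x) (K * r m x)).indicator 1 y
        = ENNReal.ofReal K * ∑' x : t m, volume (Metric.closedBall (x : ℝ) (r m x)) := by
          rw [← ENNReal.tsum_mul_left]
          refine tsum_congr fun x => ?_
          rw [lintegral_indicator_one Metric.isClosed_closedBall.measurableSet]
          exact volume_closedBall_mul hK _ _ _
      _ ≤ _ := by
          gcongr
          exact hsum m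
  have hlim : ∫⁻ y, liminf (fun m => N m y) atTop ≠ ⊤ := by
    have hC : ENNReal.ofReal K * (volume S + 1) ≠ ⊤ :=
      ENNReal.mul_ne_top ENNReal.ofReal_ne_top (ENNReal.add_ne_top.2 ⟨hfin, ENNReal.one_ne_top⟩)
    refine ne_top_of_le_ne_top hC ((lintegral_liminf_le hmeas).trans
      (liminf_le_of_le (by isBoundedDefault) fun b hb => ?_))
    obtain ⟨m, hm⟩ := hb.exists
    exact hm.trans (hint m)
  filter_upwards [ae_lt_top (Measurable.liminf hmeas) hlim] with y hy
  by_contra hinf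
  refine hy.ne (ENNReal.eq_top_of_forall_nnreal_le fun M => ?_)
  obtain ⟨n, hn⟩ := exists_nat_ge M
  obtain ⟨u, hu, hcard⟩ := Set.Infinite.exists_subset_card_eq hinf n
  refine le_trans (b := (n : ℝ≥0∞)) (by exact_mod_cast hn) ?_
  refine le_liminf_of_le (by isBoundedDefault) ?_
  -- The radii are below `1 / (m + 1)`, so eventually no ball holds two of the `n` points of the
  -- level, and `N m y ≥ n`.
  have hsep : ∀ᶠ m : ℕ in atTop, ∀ x ∈ u, ∀ z ∈ u, x ≠ z → 2 * (1 / ((m : ℝ) + 1)) < |x - z| := by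
    refine (Finset.eventually_all u).2 fun x _ => (Finset.eventually_all u).2 fun z _ => ?_
    by_cases hxz : x = z
    · simp [hxz]
    · have h1 : Tendsto (fun m : ℕ => 2 * (1 / ((m : ℝ) + 1))) atTop (𝓝 (2 * 0)) :=
        tendsto_one_div_add_atTop_nhds_zero_nat.const_mul 2
      rw [mul_zero] at h1
      filter_upwards [h1.eventually (gt_mem_nhds (abs_pos.2 (sub_ne_zero.2 hxz)))] with m hm _
      exact hm
  filter_upwards [hsep] with m hm
  have hex : ∀ x : u, ∃ z : t m, (x : ℝ) ∈ Metric.closedBall (z : ℝ) (r m z) := by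
    intro x
    obtain ⟨z, hz, hxz⟩ := mem_iUnion₂.1 (hcov m (hu x.2).1)
    exact ⟨⟨z, hz⟩, hxz⟩
  choose g hg using hex
  have hginj : Function.Injective g := by
    intro x z hxz
    by_contra hne
    have h1 := hm x x.2 z z.2 (fun h => hne (Subtype.ext h))
    have h2 := hg x
    have h3 := hg z
    rw [← hxz] at h3
    have h4 := (htr m (g x) (g x).2).1
    rw [Metric.mem_closedBall] at h2 h3
    have h5 := dist_triangle_right (x : ℝ) (z : ℝ) (g x : ℝ)
    rw [Real.dist_eq] at h5
    linarith
  calc (n : ℝ≥0∞) = ∑ z ∈ Finset.univ.map ⟨g, hginj⟩, 1 := by simp [hcard]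
    _ = ∑ z ∈ Finset.univ.map ⟨g, hginj⟩,
          (Metric.closedBall (F z) (K * r m z)).indicator (1 : ℝ → ℝ≥0∞) y := by
        refine Finset.sum_congr rfl fun z hz => ?_
        obtain ⟨x, -, rfl⟩ := Finset.mem_map.1 hz
        have hFx : F x = y := (hu x.2).2
        rw [indicator_of_mem]
        · rfl
        · rw [← hFx]
          exact (htr m (g x) (g x).2).2 x (hg x)
    _ ≤ N m y := ENNReal.sum_le_tsum _

/-! ### Crossings of levels -/

theorem IsClosed.exists_isolated_of_countable {K : Set ℝ} (hK : IsClosed K) (hne : K.Nonempty)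
    (hc : K.Countable) : ∃ x ∈ K, ∃ δ > 0, ∀ z ∈ K, |z - x| < δ → z = x := by
  by_contra! h
  have hperf : Perfect K := ⟨hK, preperfect_iff_nhds.2 fun x hx U hU => by
    obtain ⟨δ, hδ, hU⟩ := Metric.mem_nhds_iff.1 hU
    obtain ⟨z, hz, hzx, hne⟩ := h x hx δ hδ
    exact ⟨z, ⟨hU hzx, hz⟩, hne⟩⟩
  obtain ⟨g, hg, -, hinj⟩ := hperf.exists_nat_bool_injection hne
  have h1 : (range g).Countable := hc.mono hg
  have h3 : Cardinal.mk (ℕ → Bool) = 2 ^ Cardinal.aleph0 := by simp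
  have := h1.to_subtype
  have h2 : Countable (ℕ → Bool) := (rangeFactorization_injective.2 hinj).countable
  exact (Cardinal.cantor Cardinal.aleph0).not_ge (h3 ▸ Cardinal.mk_le_aleph0_iff.2 h2)

theorem IsPreconnected.forall_lt_or_forall_gt {F : ℝ → ℝ} {S : Set ℝ} (hS : IsPreconnected S)
    (hF : ContinuousOn F S) {y : ℝ} (hne : ∀ z ∈ S, F z ≠ y) :
    (∀ z ∈ S, F z < y) ∨ ∀ z ∈ S, y < F z := by
  by_contra! h
  obtain ⟨⟨z, hz, hz'⟩, w, hw, hw'⟩ := h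
  obtain ⟨x, hx, hxy⟩ := hS.intermediate_value hw hz hF ⟨hw', hz'⟩
  exact hne x hx hxy

/-- The points of `[p, q]` that separate smaller from larger values of `F` on `[p, q]`. -/
def crossingSet (F : ℝ → ℝ) (p q : ℝ) : Set ℝ :=
  {x | x ∈ Ioo p q ∧ ∀ z ∈ Icc p q, (z ≤ x → F z ≤ F x) ∧ (x ≤ z → F x ≤ F z)}

/-- Near an isolated point of the level, `F - y` has constant sign on each side. Equal signs would
make `y` an extremum over a rational interval, which `hsup` and `hinf` exclude. -/
theorem exists_mem_crossingSet {F : ℝ → ℝ} {a b y : ℝ} (hF : ContinuousOn F (Icc a b))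
    (hab : a ≤ b) (hy : y ∈ Ioo (F a) (F b)) (hc : (Icc a b ∩ F ⁻¹' {y}).Countable)
    (hsup : ∀ p q : ℚ, sSup (F '' Icc (p : ℝ) q) ≠ y)
    (hinf : ∀ p q : ℚ, sInf (F '' Icc (p : ℝ) q) ≠ y) :
    ∃ x ∈ Ioo a b, F x = y ∧ ∃ p q : ℚ, Icc (p : ℝ) q ⊆ Ioo a b ∧
      (x ∈ crossingSet F p q ∨ x ∈ crossingSet (-F) p q) := by
  have hclosed : IsClosed (Icc a b ∩ F ⁻¹' {y}) := hF.preimage_isClosed_of_isClosed isClosed_Icc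
    isClosed_singleton
  have hne : (Icc a b ∩ F ⁻¹' {y}).Nonempty := by
    obtain ⟨x, hx, hxy⟩ := intermediate_value_Icc hab hF (Ioo_subset_Icc_self hy)
    exact ⟨x, hx, hxy⟩
  obtain ⟨x, ⟨hx, hxy⟩, δ, hδ, hiso⟩ := hclosed.exists_isolated_of_countable hne hc
  rw [mem_preimage, mem_singleton_iff] at hxy
  have hxa : a < x := lt_of_le_of_ne hx.1 fun h => hy.1.ne (by rw [h, hxy])
  have hxb : x < b := lt_of_le_of_ne hx.2 fun h => hy.2.ne (by rw [← h, hxy])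
  obtain ⟨p, hp, hpx⟩ := exists_rat_btwn (max_lt hxa (sub_lt_self x hδ))
  obtain ⟨q, hxq, hq⟩ := exists_rat_btwn (lt_min hxb (lt_add_of_pos_right x hδ))
  obtain ⟨hap, hpδ⟩ := max_lt_iff.1 hp
  obtain ⟨hqb, hqδ⟩ := lt_min_iff.1 hq
  have hpq : Icc (p : ℝ) q ⊆ Ioo a b := fun z hz => ⟨hap.trans_le hz.1, hz.2.trans_lt hqb⟩
  have hFpq : ContinuousOn F (Icc p q) := hF.mono (hpq.trans Ioo_subset_Icc_self)
  have hney : ∀ z ∈ Icc (p : ℝ) q, z ≠ x → F z ≠ y := fun z hz hzx h =>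
    hzx (hiso z ⟨Ioo_subset_Icc_self (hpq hz), h⟩
      (abs_lt.2 ⟨by linarith [hz.1], by linarith [hz.2]⟩))
  have hxpq : x ∈ Icc (p : ℝ) q := ⟨hpx.le, hxq.le⟩
  have hl := isPreconnected_Ico.forall_lt_or_forall_gt (S := Ico (p : ℝ) x)
    (hFpq.mono fun z hz => ⟨hz.1, hz.2.le.trans hxq.le⟩)
    (fun z hz => hney z ⟨hz.1, hz.2.le.trans hxq.le⟩ hz.2.ne)
  have hr := isPreconnected_Ioc.forall_lt_or_forall_gt (S := Ioc x (q : ℝ))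
    (hFpq.mono fun z hz => ⟨hpx.le.trans hz.1.le, hz.2⟩)
    (fun z hz => hney z ⟨hpx.le.trans hz.1.le, hz.2⟩ hz.1.ne')
  refine ⟨x, ⟨hxa, hxb⟩, hxy, p, q, hpq, ?_⟩
  rcases hl with hl | hl <;> rcases hr with hr | hr
  · refine absurd (IsGreatest.csSup_eq (s := F '' Icc (p : ℝ) q) ⟨⟨x, hxpq, hxy⟩, ?_⟩) (hsup p q)
    rintro _ ⟨z, hz, rfl⟩
    rcases lt_trichotomy z x with h | h | h
    · exact (hl z ⟨hz.1, h⟩).le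
    · rw [h, hxy]
    · exact (hr z ⟨h, hz.2⟩).le
  · refine Or.inl ⟨⟨hpx, hxq⟩, fun z hz => ⟨fun h => ?_, fun h => ?_⟩⟩
    · rcases h.eq_or_lt with rfl | h
      · rfl
      · exact hxy ▸ (hl z ⟨hz.1, h⟩).le
    · rcases h.eq_or_lt with rfl | h
      · rfl
      · exact hxy ▸ (hr z ⟨h, hz.2⟩).le
  · refine Or.inr ⟨⟨hpx, hxq⟩, fun z hz => ⟨fun h => ?_, fun h => ?_⟩⟩
    · rcases h.eq_or_lt with rfl | h
      · rfl
      · exact neg_le_neg (hxy ▸ (hl z ⟨hz.1, h⟩).le)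
    · rcases h.eq_or_lt with rfl | h
      · rfl
      · exact neg_le_neg (hxy ▸ (hr z ⟨h, hz.2⟩).le)
  · refine absurd (IsLeast.csInf_eq (s := F '' Icc (p : ℝ) q) ⟨⟨x, hxpq, hxy⟩, ?_⟩) (hinf p q)
    rintro _ ⟨z, hz, rfl⟩
    rcases lt_trichotomy z x with h | h | h
    · exact (hl z ⟨hz.1, h⟩).le
    · rw [h, hxy]
    · exact (hr z ⟨h, hz.2⟩).le

/-- `G - H` has a local minimum at `x`, so the two barriers share their derivative and squeeze `F`.
-/
theorem DifferentiableAt.of_le_of_le {F G H : ℝ → ℝ} {x : ℝ} (hG : DifferentiableAt ℝ G x)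
    (hH : DifferentiableAt ℝ H x) (hHF : ∀ᶠ z in 𝓝 x, H z ≤ F z) (hFG : ∀ᶠ z in 𝓝 x, F z ≤ G z)
    (hGx : G x = F x) (hHx : H x = F x) : DifferentiableAt ℝ F x := by
  have hmin : IsLocalMin (fun z => G z - H z) x := by
    filter_upwards [hHF, hFG] with z h1 h2
    rw [hGx, hHx]
    linarith
  have hd := hmin.hasDerivAt_eq_zero (hG.hasDerivAt.sub hH.hasDerivAt)
  have hG' := hG.hasDerivAt
  have hH' := hH.hasDerivAt
  rw [← sub_eq_zero.1 hd] at hH'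
  refine HasDerivAt.differentiableAt (f' := deriv G x) ?_
  rw [hasDerivAt_iff_isLittleO] at hG' hH' ⊢
  refine Asymptotics.IsBigO.trans_isLittleO ?_ (hG'.norm_left.add hH'.norm_left)
  refine Asymptotics.IsBigO.of_bound 1 ?_
  filter_upwards [hHF, hFG] with z h1 h2
  rw [hGx, hHx, one_mul]
  refine le_trans ?_ (Real.le_norm_self _)
  simp only [Real.norm_eq_abs]
  rw [abs_le]
  constructor
  · linarith [neg_abs_le (H z - F x - (z - x) • deriv G x),
      abs_nonneg (G z - F x - (z - x) • deriv G x)]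
  · linarith [le_abs_self (G z - F x - (z - x) • deriv G x),
      abs_nonneg (H z - F x - (z - x) • deriv G x)]

theorem ae_differentiableAt_of_mem_crossingSet {F : ℝ → ℝ} {p q : ℝ}
    (hF : ContinuousOn F (Icc p q)) : ∀ᵐ x, x ∈ crossingSet F p q → DifferentiableAt ℝ F x := by
  have hbdd : ∀ z w, p ≤ z → w ≤ q → BddAbove (F '' Icc z w) ∧ BddBelow (F '' Icc z w) := by
    intro z w hz hw
    have hcomp := isCompact_Icc.image_of_continuousOn (hF.mono (Icc_subset_Icc hz hw))
    exact ⟨hcomp.bddAbove, hcomp.bddBelow⟩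
  have hG : MonotoneOn (fun z => sSup (F '' Icc p z)) (Icc p q) := fun z hz w hw hzw =>
    csSup_le_csSup (hbdd p w le_rfl hw.2).1 ((nonempty_Icc.2 hz.1).image F)
      (image_mono (Icc_subset_Icc_right hzw))
  have hH : MonotoneOn (fun z => sInf (F '' Icc z q)) (Icc p q) := fun z hz w hw hzw =>
    csInf_le_csInf (hbdd z q hz.1 le_rfl).2 ((nonempty_Icc.2 hw.2).image F)
      (image_mono (Icc_subset_Icc_left hzw))
  filter_upwards [hG.ae_differentiableWithinAt_of_mem, hH.ae_differentiableWithinAt_of_mem]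
    with x h1 h2 hx
  have hnhds : Icc p q ∈ 𝓝 x := Icc_mem_nhds hx.1.1 hx.1.2
  have hxI : x ∈ Icc p q := Ioo_subset_Icc_self hx.1
  refine DifferentiableAt.of_le_of_le ((h1 hxI).differentiableAt hnhds)
    ((h2 hxI).differentiableAt hnhds) ?_ ?_ ?_ ?_
  · filter_upwards [hnhds] with z hz
    exact csInf_le (hbdd z q hz.1 le_rfl).2 ⟨z, left_mem_Icc.2 hz.2, rfl⟩
  · filter_upwards [hnhds] with z hz
    exact le_csSup (hbdd p z le_rfl hz.2).1 ⟨z, right_mem_Icc.2 hz.1, rfl⟩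
  · refine IsGreatest.csSup_eq ⟨⟨x, right_mem_Icc.2 hxI.1, rfl⟩, ?_⟩
    rintro _ ⟨z, hz, rfl⟩
    exact (hx.2 z ⟨hz.1, hz.2.trans hxI.2⟩).1 hz.2
  · refine IsLeast.csInf_eq ⟨⟨x, left_mem_Icc.2 hxI.2, rfl⟩, ?_⟩
    rintro _ ⟨z, hz, rfl⟩
    exact (hx.2 z ⟨hxI.1.trans hz.1, hz.2⟩).2 hz.1

/-! ### Differentiability on a set of positive measure -/

theorem volume_differentiableAt_pos_of_lt {F : ℝ → ℝ} {a b : ℝ} {N : Set ℝ}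
    (hF : ContinuousOn F (Icc a b)) (hN : N.Countable) (hab : a ≤ b) (hlt : F a < F b)
    (hosc : ∀ x ∈ Ioo a b, x ∉ N →
      ∃ K : ℕ, ∃ᶠ r in 𝓝[>] (0 : ℝ), ∀ y, |y - x| ≤ r → |F y - F x| ≤ K * r) :
    volume (Ioo a b ∩ {x | DifferentiableAt ℝ F x}) ≠ 0 := by
  intro hD
  set A : ℕ → Set ℝ := fun K => {x ∈ Ioo a b |
    ∃ᶠ r in 𝓝[>] (0 : ℝ), ∀ y, |y - x| ≤ r → |F y - F x| ≤ K * r}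
  have hAN : ∀ x ∈ Ioo a b, x ∈ (⋃ K, A K) ∪ N := by
    intro x hx
    by_cases hxN : x ∈ N
    · exact Or.inr hxN
    · obtain ⟨K, hK⟩ := hosc x hx hxN
      exact Or.inl (mem_iUnion.2 ⟨K, hx, hK⟩)
  set X : Set ℝ := {x ∈ Ioo a b | ∃ p q : ℚ, Icc (p : ℝ) q ⊆ Ioo a b ∧
      (x ∈ crossingSet F p q ∨ x ∈ crossingSet (-F) p q)}
  have hX : volume X = 0 := by
    have hae : ∀ᵐ x, ∀ p q : ℚ, Icc (p : ℝ) q ⊆ Ioo a b →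
        (x ∈ crossingSet F p q ∨ x ∈ crossingSet (-F) p q) → DifferentiableAt ℝ F x := by
      refine ae_all_iff.2 fun p => ae_all_iff.2 fun q => ?_
      by_cases hpq : Icc (p : ℝ) q ⊆ Ioo a b
      · have hFpq := hF.mono (hpq.trans Ioo_subset_Icc_self)
        filter_upwards [ae_differentiableAt_of_mem_crossingSet hFpq,
          ae_differentiableAt_of_mem_crossingSet hFpq.neg] with x h1 h2 _ h3
        exact h3.elim h1 fun h => differentiableAt_neg_iff.1 (h2 h)
      · exact .of_forall fun x h => absurd h hpq
    refine measure_mono_null ?_ (measure_union_null hD hae)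
    rintro x ⟨hx, p, q, hpq, hcross⟩
    by_cases hd : DifferentiableAt ℝ F x
    · exact Or.inl ⟨hx, hd⟩
    · exact Or.inr fun h => hd (h p q hpq hcross)
  have hFX : volume (F '' X) = 0 := by
    have h1 : ∀ K, volume (F '' (X ∩ A K)) = 0 := fun K =>
      volume_image_eq_zero_of_frequently_oscillation_le K.cast_nonneg (fun x hx => hx.2.2)
        (measure_mono_null inter_subset_left hX)
    refine measure_mono_null ?_ (measure_union_null (measure_iUnion_null h1)
      ((hN.image F).measure_zero volume))
    rintro _ ⟨x, hx, rfl⟩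
    rcases hAN x hx.1 with h | h
    · obtain ⟨K, hK⟩ := mem_iUnion.1 h
      exact Or.inl (mem_iUnion.2 ⟨K, x, ⟨hx, hK⟩, rfl⟩)
    · exact Or.inr ⟨x, h, rfl⟩
  have hfin : ∀ᵐ y, ∀ K, (A K ∩ F ⁻¹' {y}).Finite := ae_all_iff.2 fun K =>
    ae_finite_inter_preimage_of_frequently_oscillation_le K.cast_nonneg (fun x hx => hx.2)
      (measure_mono (sep_subset _ _) |>.trans_lt measure_Ioo_lt_top).ne
  have hsup : ∀ᵐ y, ∀ p q : ℚ, sSup (F '' Icc (p : ℝ) q) ≠ y := by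
    refine ae_all_iff.2 fun p => ae_all_iff.2 fun q => ?_
    filter_upwards [Measure.ae_ne volume (sSup (F '' Icc (p : ℝ) q))] with y hy using hy.symm
  have hinf : ∀ᵐ y, ∀ p q : ℚ, sInf (F '' Icc (p : ℝ) q) ≠ y := by
    refine ae_all_iff.2 fun p => ae_all_iff.2 fun q => ?_
    filter_upwards [Measure.ae_ne volume (sInf (F '' Icc (p : ℝ) q))] with y hy using hy.symm
  have hcov : ∀ᵐ y, y ∈ Ioo (F a) (F b) → y ∈ F '' X := by
    filter_upwards [hfin, hsup, hinf] with y h1 h2 h3 hy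
    have hc : (Icc a b ∩ F ⁻¹' {y}).Countable := by
      refine ((countable_iUnion fun K => (h1 K).countable).union
        (hN.union (countable_insert.2 (countable_singleton b) : ({a, b} : Set ℝ).Countable))).mono ?_
      rintro x ⟨hx, hxy⟩
      rcases hx.1.eq_or_lt with rfl | hax
      · simp
      rcases hx.2.eq_or_lt with rfl | hxb
      · simp
      rcases hAN x ⟨hax, hxb⟩ with h | h
      · obtain ⟨K, hK⟩ := mem_iUnion.1 h
        exact Or.inl (mem_iUnion.2 ⟨K, hK, hxy⟩)
      · exact Or.inr (Or.inl h)
    obtain ⟨x, hx, hxy, hcross⟩ := exists_mem_crossingSet hF hab hy hc h2 h3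
    exact ⟨x, ⟨hx, hcross⟩, hxy⟩
  have hnull : volume (Ioo (F a) (F b)) = 0 := by
    refine measure_mono_null ?_ (measure_union_null hFX hcov)
    intro y hy
    by_cases h : y ∈ F '' X
    · exact Or.inl h
    · exact Or.inr fun h' => h (h' hy)
  rw [Real.volume_Ioo, ENNReal.ofReal_eq_zero] at hnull
  linarith

theorem volume_differentiableAt_pos {F : ℝ → ℝ} {a b : ℝ} {N : Set ℝ}
    (hF : ContinuousOn F (Ioo a b)) (hN : N.Countable) (hab : a < b)
    (hosc : ∀ x ∈ Ioo a b, x ∉ N →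
      ∃ K : ℕ, ∃ᶠ r in 𝓝[>] (0 : ℝ), ∀ y, |y - x| ≤ r → |F y - F x| ≤ K * r) :
    volume (Ioo a b ∩ {x | DifferentiableAt ℝ F x}) ≠ 0 := by
  by_cases hconst : ∀ x ∈ Ioo a b, ∀ y ∈ Ioo a b, x < y → F x = F y
  · have hsub : Ioo a b ⊆ Ioo a b ∩ {x | DifferentiableAt ℝ F x} := by
      refine fun x hx => ⟨hx, ?_⟩
      refine (differentiableAt_const (F x)).congr_of_eventuallyEq ?_
      filter_upwards [Ioo_mem_nhds hx.1 hx.2] with z hz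
      rcases lt_trichotomy z x with h | h | h
      · exact hconst z hz x hx h
      · rw [h]
      · exact (hconst x hx z hz h).symm
    refine fun h0 => ?_
    have := measure_mono_null hsub h0
    rw [Real.volume_Ioo, ENNReal.ofReal_eq_zero] at this
    linarith
  · push Not at hconst
    obtain ⟨x, hx, y, hy, hxy, hne⟩ := hconst
    have hsub : Icc x y ⊆ Ioo a b := fun z hz => ⟨hx.1.trans_le hz.1, hz.2.trans_lt hy.2⟩
    have hsub' := Ioo_subset_Icc_self.trans hsub
    rcases hne.lt_or_gt with h | h
    · have := volume_differentiableAt_pos_of_lt (hF.mono hsub) hN hxy.le h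
        fun z hz => hosc z (hsub' hz)
      exact fun h0 => this (measure_mono_null (inter_subset_inter_left _ hsub') h0)
    · have := volume_differentiableAt_pos_of_lt (F := -F) (hF.mono hsub).neg hN hxy.le
        (neg_lt_neg h) fun z hz hzN => by
          obtain ⟨K, hK⟩ := hosc z (hsub' hz) hzN
          refine ⟨K, hK.mono fun r hr w hw => ?_⟩
          have := hr w hw
          rwa [Pi.neg_apply, Pi.neg_apply, neg_sub_neg, abs_sub_comm]
      refine fun h0 => this (measure_mono_null (inter_subset_inter hsub' fun z hz => ?_) h0)
      exact differentiableAt_neg_iff.1 hz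

/-! ### Transfer to the curve and its graph -/

theorem tendsto_rightInverse_of_isCompact {X Y : Type*} [TopologicalSpace X] [TopologicalSpace Y]
    [T2Space Y] {K : Set X} (hK : IsCompact K) {Γ : X → Y} (hΓ : ContinuousOn Γ K) {γ : Set Y}
    {φ : γ → X} (hφ : ∀ y, φ y ∈ K ∧ Γ (φ y) = y) {t : X} {x : γ}
    (ht : ∀ s ∈ K, Γ s = x → s = t) : Tendsto φ (𝓝 x) (𝓝 t) := by
  rw [tendsto_nhds]
  intro U hU htU
  have hcl : IsClosed (Γ '' (K \ U)) := ((hK.diff hU).image_of_continuousOn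
    (hΓ.mono sdiff_subset)).isClosed
  have hx : (x : Y) ∈ (Γ '' (K \ U))ᶜ := by
    rintro ⟨s, hs, hsx⟩
    exact hs.2 (ht s hs.1 hsx ▸ htU)
  filter_upwards [continuous_subtype_val.continuousAt (hcl.isOpen_compl.mem_nhds hx)] with y hy
  by_contra hyU
  exact hy ⟨φ y, ⟨(hφ y).1, hyU⟩, (hφ y).2⟩

theorem HasDerivAt.isBigO_sub_nhds {E : Type*} [NormedAddCommGroup E] [NormedSpace ℝ E]
    {g : ℝ → E} {w : E} {t : ℝ} (hg : HasDerivAt g w t) (hw : w ≠ 0) :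
    (fun s => s - t) =O[𝓝 t] fun s => g s - g t :=
  (HasDerivAtFilter.isTheta_sub hg hw).isBigO_symm.comp_tendsto
    (tendsto_id.prodMk (tendsto_pure.2 (.of_forall fun _ => rfl)))

theorem mem_span_singleton_of_norm_sq_smul_sub_inner_smul_eq_zero {E : Type*}
    [NormedAddCommGroup E] [InnerProductSpace ℝ E] {w u : E} (hw : w ≠ 0)
    (h : ‖w‖ ^ 2 • u - inner ℝ w u • w = 0) : u ∈ Submodule.span ℝ {w} := by
  have hw' : ‖w‖ ^ 2 ≠ 0 := pow_ne_zero 2 (norm_ne_zero_iff.2 hw)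
  refine Submodule.mem_span_singleton.2 ⟨(‖w‖ ^ 2)⁻¹ * inner ℝ w u, ?_⟩
  rw [mul_smul, ← sub_eq_zero.1 h, inv_smul_smul₀ hw']

theorem isTangentLineAt_span_singleton {E : Type*} [NormedAddCommGroup E] [InnerProductSpace ℝ E]
    {G : Set E} {g : ℝ → E} {w : E} {t : ℝ} (hg : HasDerivAt g w t) (hw : w ≠ 0)
    (hgG : ∀ᶠ s in 𝓝 t, g s ∈ G)
    (hlift : ∀ y : ℕ → E, (∀ k, y k ∈ G) → Tendsto y atTop (𝓝 (g t)) →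
      ∃ s : ℕ → ℝ, Tendsto s atTop (𝓝 t) ∧ ∀ k, y k = g (s k)) :
    IsTangentLineAt G (g t) (Submodule.span ℝ {w}) := by
  refine ⟨finrank_span_singleton hw, ?_⟩
  ext u
  constructor
  · rintro ⟨y, hy, hyt, hyu⟩
    obtain ⟨s, hs, hsy⟩ := hlift y (fun k => (hy k).1) hyt
    constructor
    -- `T` is `‖w‖ ^ 2` times the projection onto the orthogonal complement of `w`. As `T w = 0`,
    -- `T` kills the limits of normalized secants.
    · set T : E →L[ℝ] E := ‖w‖ ^ 2 • ContinuousLinearMap.id ℝ E -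
        (innerSL ℝ w).smulRight w with hT
      have hTapp : ∀ z, T z = ‖w‖ ^ 2 • z - inner ℝ w z • w := fun z => by simp [hT]
      have hTw : T w = 0 := by rw [hTapp, real_inner_self_eq_norm_sq, sub_self]
      have hTg : HasDerivAt (fun s => T (g s)) 0 t := by
        have := T.hasFDerivAt.comp_hasDerivAt t hg
        rwa [hTw] at this
      have hlo : (fun s => T (g s - g t)) =o[𝓝 t] fun s => ‖g s - g t‖ := by
        have h1 := hasDerivAt_iff_isLittleO.1 hTg
        simp only [smul_zero, sub_zero, ← map_sub] at h1
        exact (h1.trans_isBigO (hg.isBigO_sub_nhds hw)).norm_right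
      have hlim := (hlo.comp_tendsto hs).tendsto_inv_smul_nhds_zero
      have hlim2 := (T.continuous.tendsto u).comp hyu
      refine mem_span_singleton_of_norm_sq_smul_sub_inner_smul_eq_zero hw ?_
      rw [← hTapp]
      refine tendsto_nhds_unique hlim2 (hlim.congr fun k => ?_)
      simp [hsy k]
    · refine tendsto_nhds_unique hyu.norm (tendsto_const_nhds.congr fun k => ?_)
      rw [norm_smul, norm_inv, norm_norm,
        inv_mul_cancel₀ (norm_ne_zero_iff.2 (sub_ne_zero.2 (hy k).2))]
  · rintro ⟨huw, hu⟩
    obtain ⟨c, rfl⟩ := Submodule.mem_span_singleton.1 huw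
    have hc : c ≠ 0 := by
      rintro rfl
      simp at hu
    set r : ℕ → ℝ := fun k => 1 / ((k : ℝ) + 1)
    have hrpos : ∀ k, 0 < r k := fun k => Nat.one_div_pos_of_nat
    have hr : Tendsto r atTop (𝓝 0) := tendsto_one_div_add_atTop_nhds_zero_nat
    -- The sign of `c` selects the side of approach, hence the half-tangent.
    set s : ℕ → ℝ := fun k => t + c * r k with hs
    have hst : Tendsto s atTop (𝓝[≠] t) := by
      refine tendsto_nhdsWithin_iff.2 ⟨?_, .of_forall fun k => ?_⟩
      · simpa using (hr.const_mul c).const_add t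
      · simp [hs, hc, (hrpos k).ne']
    have hst' := hst.mono_right nhdsWithin_le_nhds
    obtain ⟨M, hM⟩ := eventually_atTop.1
      ((hst'.eventually hgG).and (hst.eventually (hg.eventually_ne hw (c := g t))))
    refine ⟨fun k => g (s (k + M)), fun k => hM _ (Nat.le_add_left M k), ?_, ?_⟩
    · exact ((hg.continuousAt.tendsto.comp hst').comp (tendsto_add_atTop_nat M))
    · have hslope := (hasDerivAt_iff_tendsto_slope.1 hg).comp hst
      have h1 : Tendsto (fun k => (r k)⁻¹ • (g (s k) - g t)) atTop (𝓝 (c • w)) := by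
        refine (hslope.const_smul c).congr fun k => ?_
        have : s k - t = c * r k := by simp [hs]
        simp only [Function.comp_apply, slope, vsub_eq_sub, this]
        rw [smul_smul, mul_inv, mul_inv_cancel_left₀ hc]
      have h2 := (h1.norm.inv₀ (by rw [hu]; exact one_ne_zero)).smul h1
      rw [hu, inv_one, one_smul] at h2
      refine (h2.comp (tendsto_add_atTop_nat M)).congr fun k => ?_
      simp only [Function.comp_apply]
      have hrk := hrpos (k + M)
      rw [norm_smul, norm_inv, Real.norm_of_nonneg hrk.le, mul_inv, inv_inv, smul_smul]
      congr 1
      field_simp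

theorem HasDerivAt.graphPoint {V : Type*} [NormedAddCommGroup V] [InnerProductSpace ℝ V]
    {Γ : ℝ → V} {F : ℝ → ℝ} {v : V} {d t : ℝ} (hΓ : HasDerivAt Γ v t) (hF : HasDerivAt F d t) :
    HasDerivAt (fun s => graphPoint (Γ s) (F s)) (graphPoint v d) t :=
  (WithLp.prodContinuousLinearEquiv 2 ℝ V ℝ).symm.toContinuousLinearMap.hasFDerivAt.comp_hasDerivAt
    t (hΓ.prodMk hF)

theorem DifferentiableAtOnCurve.of_hasDerivAt {V : Type*} [NormedAddCommGroup V]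
    [InnerProductSpace ℝ V] {γ : Set V} {f : γ → ℝ} {x : γ} {Γ : ℝ → V} {F : ℝ → ℝ} {v : V}
    {d t : ℝ} {φ : γ → ℝ} (hφ : ∀ y, Γ (φ y) = y ∧ F (φ y) = f y)
    (hφt : Tendsto φ (𝓝 x) (𝓝 t)) (hx : Γ t = x) (hFx : F t = f x)
    (hG : ∀ᶠ s in 𝓝 t, graphPoint (Γ s) (F s) ∈ _root_.graphOn f)
    (hΓ : HasDerivAt Γ v t) (hv : v ≠ 0) (hF : HasDerivAt F d t) :
    DifferentiableAtOnCurve f x := by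
  have hw : graphPoint v d ≠ 0 := fun h => hv (congrArg WithLp.fst h)
  constructor
  · have hv2 : ‖v‖ ^ 2 ≠ 0 := pow_ne_zero 2 (norm_ne_zero_iff.2 hv)
    refine ⟨(d / ‖v‖ ^ 2) • innerSL ℝ v, ?_⟩
    -- Only `L v = d` matters: it cancels the derivative of `F - L ∘ Γ`.
    set L := (d / ‖v‖ ^ 2) • innerSL ℝ v with hL
    have hLv : L v = d := by
      simp [hL, div_mul_cancel₀ d hv2]
    have hder : HasDerivAt (fun s => F s - L (Γ s)) 0 t := by
      have := hF.sub (L.hasFDerivAt.comp_hasDerivAt t hΓ)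
      rwa [hLv, sub_self] at this
    have h1 := hasDerivAt_iff_isLittleO.1 hder
    simp only [smul_zero, sub_zero] at h1
    refine ((h1.trans_isBigO (hΓ.isBigO_sub_nhds hv)).comp_tendsto hφt).congr
      (fun y => ?_) fun y => ?_
    · simp only [Function.comp_apply, (hφ y).1, (hφ y).2, hx, hFx, map_sub]
      ring
    · simp only [Function.comp_apply, (hφ y).1, hx]
  · refine ⟨Submodule.span ℝ {graphPoint v d}, ?_, ?_⟩
    · suffices h : IsTangentLineAt (_root_.graphOn f) (graphPoint (Γ t) (F t))
          (Submodule.span ℝ {graphPoint v d}) by rwa [hx, hFx] at h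
      refine isTangentLineAt_span_singleton (g := fun s => graphPoint (Γ s) (F s))
        (hΓ.graphPoint hF) hw hG fun y hy hyt => ?_
      choose z hz using hy
      refine ⟨fun k => φ (z k), hφt.comp ?_, fun k => ?_⟩
      · rw [tendsto_subtype_rng]
        have h1 : Continuous (fun p : WithLp 2 (V × ℝ) => p.fst) := by fun_prop
        have h2 := (h1.tendsto _).comp hyt
        change Tendsto _ _ (𝓝 (Γ t)) at h2
        rw [hx] at h2
        refine h2.congr fun k => ?_
        rw [Function.comp_apply, ← hz k]
        rfl
      · simp only [(hφ (z k)).1, (hφ (z k)).2]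
        exact (hz k).symm
    · intro h
      obtain ⟨a, ha⟩ := Submodule.mem_span_singleton.1 h
      have h1 : a • v = 0 := congrArg WithLp.fst ha
      have h2 : a * d = 1 := congrArg WithLp.snd ha
      rcases smul_eq_zero.1 h1 with h | h
      · simp [h] at h2
      · exact hv h

theorem exists_frequently_abs_sub_le_of_lowerScaledOscillation_ne_top {X : Type*}
    [PseudoMetricSpace X] {f : X → ℝ} {x : X} (h : lowerScaledOscillation f x ≠ ⊤) :
    ∃ K : ℕ, ∃ᶠ r in 𝓝[>] (0 : ℝ), ∀ y, dist y x ≤ r → |f y - f x| ≤ K * r := by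
  obtain ⟨K, hK⟩ := ENNReal.exists_nat_gt h
  refine ⟨K, ?_⟩
  have h1 := frequently_lt_of_liminf_lt (by isBoundedDefault) hK
  refine (h1.and_eventually self_mem_nhdsWithin).mono fun r hr y hy => ?_
  obtain ⟨hr, hr0⟩ := hr
  replace hr0 : 0 < r := hr0
  have h2 : ‖f y - f x‖ₑ ≤ K * ENNReal.ofReal r := by
    refine (le_iSup₂ (f := fun y (_ : y ∈ Metric.closedBall x r) => ‖f y - f x‖ₑ) y hy).trans ?_
    rw [← ENNReal.div_le_iff (ENNReal.ofReal_pos.2 hr0).ne' ENNReal.ofReal_ne_top]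
    exact hr.le
  rwa [← ofReal_norm, ← ENNReal.ofReal_natCast, ← ENNReal.ofReal_mul K.cast_nonneg,
    ENNReal.ofReal_le_ofReal_iff (by positivity), Real.norm_eq_abs] at h2

theorem corollary3p4 (n : ℕ) (γ : Set (EuclideanSpace ℝ (Fin n)))
    (hcube : ∀ x ∈ γ, ∀ i, x i ∈ Icc (0 : ℝ) 1)
    (hγ : IsSimpleCurve γ) (hlen : μH[1] γ < ⊤)
    (f : γ → ℝ) (hf : Continuous f)
    (hosc : {x : γ | lowerScaledOscillation f x = ⊤}.Countable) :
    0 < μH[1] ((fun x : γ => (x : EuclideanSpace ℝ (Fin n))) ''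
      {x : γ | DifferentiableAtOnCurve f x}) := by
  obtain ⟨l, Γ, hl, hlip, hsimple, himg, hmeas⟩ := hγ.exists_arcLength_parametrization hlen
  have hmem : ∀ s : Icc 0 l, Γ s ∈ γ := fun s => himg ▸ mem_image_of_mem Γ s.2
  have huniq : ∀ t ∈ Ioo 0 l, ∀ s ∈ Icc 0 l, Γ s = Γ t → s = t := by
    intro t ht s hs hst
    rcases lt_trichotomy s t with h | h | h
    · exact absurd (hsimple s hs t (Ioo_subset_Icc_self ht) h hst).2 ht.2.ne
    · exact h
    · exact absurd (hsimple t (Ioo_subset_Icc_self ht) s hs h hst.symm).1 ht.1.ne'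
  set c : Icc 0 l → γ := fun s => ⟨Γ s, hmem s⟩
  have hc : Continuous c :=
    (continuousOn_iff_continuous_domRestrict.1 hlip.continuousOn).subtype_mk hmem
  set C : ℝ → γ := fun s => c (projIcc 0 l hl.le s)
  have hC : ∀ s ∈ Icc 0 l, (C s : EuclideanSpace ℝ (Fin n)) = Γ s := by
    intro s hs
    simp only [C, c, projIcc_of_mem hl.le hs]
  have hF : Continuous (f ∘ C) := hf.comp (hc.comp continuous_projIcc)
  have hN : {s ∈ Ioo 0 l | lowerScaledOscillation f (C s) = ⊤}.Countable := by
    refine MapsTo.countable_of_injOn (f := C) (fun s hs => hs.2) ?_ hosc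
    intro s hs t ht hst
    have := congrArg Subtype.val hst
    rw [hC s (Ioo_subset_Icc_self hs.1), hC t (Ioo_subset_Icc_self ht.1)] at this
    exact huniq t ht.1 s (Ioo_subset_Icc_self hs.1) this
  have hpos := volume_differentiableAt_pos (F := f ∘ C) hF.continuousOn hN hl (by
    intro s hs hsN
    obtain ⟨K, hK⟩ := exists_frequently_abs_sub_le_of_lowerScaledOscillation_ne_top
      (fun h => hsN ⟨hs, h⟩)
    -- Radii below the distance to the endpoints keep `y` in `[0, l]`, where `C` agrees with `Γ`.
    refine ⟨K, (hK.and_eventually (Ioo_mem_nhdsGT (lt_min hs.1 (sub_pos.2 hs.2)))).mono ?_⟩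
    rintro r ⟨hr, -, hrl⟩ y hy
    obtain ⟨h1, h2⟩ := lt_min_iff.1 hrl
    obtain ⟨h3, h4⟩ := abs_le.1 hy
    have hyI : y ∈ Icc 0 l := ⟨by linarith, by linarith⟩
    have hsI := Ioo_subset_Icc_self hs
    refine hr (C y) ?_
    rw [Subtype.dist_eq, hC y hyI, hC s hsI]
    have := hlip.dist_le_mul y hyI s hsI
    rw [NNReal.coe_one, one_mul] at this
    exact this.trans hy)
  have hdiff : volume {s ∈ Ioo 0 l | ¬ DifferentiableAt ℝ Γ s} = 0 := by
    refine measure_mono_null ?_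
      (hlip.mono Ioo_subset_Icc_self).ae_differentiableWithinAt_of_mem_real
    exact fun s hs h => hs.2 ((h hs.1).differentiableAt (Ioo_mem_nhds hs.1.1 hs.1.2))
  have hzero : volume {s ∈ Ioo 0 l | HasDerivAt Γ 0 s} = 0 := by
    rw [← hmeas _ (sep_subset _ _)]
    exact hausdorffMeasure_image_eq_zero_of_hasDerivAt_zero (fun t ht => ht.2)
      ((measure_mono (sep_subset _ _)).trans_lt measure_Ioo_lt_top).ne
  set P : Set ℝ := {s ∈ Ioo 0 l | DifferentiableAt ℝ (f ∘ C) s ∧ DifferentiableAt ℝ Γ s ∧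
    ¬ HasDerivAt Γ 0 s}
  have hP : volume P ≠ 0 := by
    refine fun h0 => hpos (measure_mono_null ?_
      (measure_union_null h0 (measure_union_null hdiff hzero)))
    rintro s ⟨hs, hsd⟩
    by_cases h1 : DifferentiableAt ℝ Γ s
    · by_cases h2 : HasDerivAt Γ 0 s
      · exact Or.inr (Or.inr ⟨hs, h2⟩)
      · exact Or.inl ⟨hs, hsd, h1, h2⟩
    · exact Or.inr (Or.inl ⟨hs, h1⟩)
  rw [← hmeas P (sep_subset _ _)] at hP
  refine (pos_iff_ne_zero.2 hP).trans_le (measure_mono ?_)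
  rintro _ ⟨t, ⟨ht, hFt, hΓt, hne⟩, rfl⟩
  have htI := Ioo_subset_Icc_self ht
  refine ⟨C t, ?_, hC t htI⟩
  have hex : ∀ y : γ, ∃ s ∈ Icc 0 l, Γ s = y := fun y => by
    have h : (y : EuclideanSpace ℝ (Fin n)) ∈ Γ '' Icc 0 l := himg.symm ▸ y.2
    exact h
  choose φ hφ hφΓ using hex
  refine DifferentiableAtOnCurve.of_hasDerivAt (φ := φ) (F := f ∘ C) (fun y => ⟨hφΓ y, ?_⟩) ?_
    (hC t htI).symm rfl ?_ hΓt.hasDerivAt (fun h => hne (h ▸ hΓt.hasDerivAt)) hFt.hasDerivAt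
  · exact congrArg f (Subtype.ext ((hC _ (hφ y)).trans (hφΓ y)))
  · refine tendsto_rightInverse_of_isCompact isCompact_Icc hlip.continuousOn
      (fun y => ⟨hφ y, hφΓ y⟩) fun s hs hst => huniq t ht s hs (hst.trans (hC t htI))
  · filter_upwards [Icc_mem_nhds ht.1 ht.2] with s hs
    exact ⟨C s, by simp only [Function.comp_apply, hC s hs]⟩
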